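/- Let $n\ge 1$ and let $P\in\mathbb{R}^{n\times n}$ be a (row-)stochastic matrix: its entries are nonnegative and each row sums to $1$. Assume that $P$ is irreducible (the directed graph on $\{1,\dots,n\}$ with an edge $s\to t$ whenever $P_{st}>0$ is strongly connected) and aperiodic (for every $s$, $\gcd\{m : (P^m)_{ss}>0\}=1$). Let $\mathbf 1$ denote the column vector of $n$ ones. Then: 1. The map $x^T\mapsto x^T\bigl(P-\tfrac1n\mathbf 1\mathbf 1^T\bigr)+\tfrac1n\mathbf 1^T$ on $\mathbb{R}^n$ has exactly one fixpoint $u^T$. The vector $u$ is stochastic ($u\ge 0$ and $u^T\mathbf 1=1$), and $u^T$ is a left eigenvector of $P$ for the eigenvalue $1$. Moreover $y^TP^m\to u^T$ as $m\to\infty$ for every stochastic vector $y$, and $EP^m\to\mathbf 1u^T$ as $m\to\infty$ for every stochastic matrix $E\in\mathbb{R}^{n\times n}$. 2. For a state $t$ and $m\ge 1$ let $f_m$ be the probability that the Markov chain with transition matrix $P$, started in $t$ at time $0$, returns to $t$ for the first time at time $m$, that is, $$f_m=\sum_{\substack{x_0,\dots,x_m\in\{1,\dots,n\}\\ x_0=x_m=t,\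 x_1,\dots,x_{m-1}\ne t}}\ \prod_{k=0}^{m-1}P_{x_kx_{k+1}} .$$ Then $\sum_{m\ge1}f_m=1$, the mean first recurrence time $\mu_t=\sum_{m\ge 1}m f_m$ is finite and positive, and $(P^m)_{st}\to 1/\mu_t$ as $m\to\infty$ for every state $s$; in particular $(P^m)_{tt}\to 1/\mu_t$. -/

import Mathlib

open Filter Topology

namespace FiniteMarkov

/-- `P` is aperiodic: for every state `s`, the greatest common divisor of the set of all `m` with
`(P ^ m) s s > 0` is `1`. (The element `m = 0` of this set does not influence the gcd.) -/
def IsAperiodic {n : ℕ} (P : Matrix (Fin n) (Fin n) ℝ) : Prop :=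
  ∀ s : Fin n, Nat.setGcd {m : ℕ | 0 < (P ^ m) s s} = 1

/-- The map `xᵀ ↦ xᵀ (P - (1/n) 1 1ᵀ) + (1/n) 1ᵀ` on row vectors. -/
noncomputable def shiftMap {n : ℕ} (P : Matrix (Fin n) (Fin n) ℝ) (x : Fin n → ℝ) : Fin n → ℝ :=
  Matrix.vecMul x (P - (1 / (n : ℝ)) • Matrix.vecMulVec 1 1) + (1 / (n : ℝ)) • (1 : Fin n → ℝ)

/-- The probability that the Markov chain with transition matrix `P`, started in state `s` at
time `0`, is in state `x k` at each time `k = 0, 1, …, m`. -/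
noncomputable def trajectoryProb {n : ℕ} (P : Matrix (Fin n) (Fin n) ℝ) (s : Fin n) {m : ℕ}
    (x : Fin (m + 1) → Fin n) : ℝ :=
  if x 0 = s then ∏ k : Fin m, P (x k.castSucc) (x k.succ) else 0

/-- The trajectory `x` over the times `0, …, m` makes its first return to `t` at time `m`: it is in
state `t` at time `m ≥ 1`, and at no time strictly between `0` and `m`. -/
def IsFirstReturn {n : ℕ} (t : Fin n) {m : ℕ} (x : Fin (m + 1) → Fin n) : Prop :=
  1 ≤ m ∧ x (Fin.last m) = t ∧ ∀ k : Fin (m + 1), 0 < k → k < Fin.last m → x k ≠ t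

open Classical in
/-- The probability `f_m` that the chain started in state `t` first returns to `t` at time `m`. -/
noncomputable def firstReturnProb {n : ℕ} (P : Matrix (Fin n) (Fin n) ℝ) (t : Fin n) (m : ℕ) : ℝ :=
  ∑ x : Fin (m + 1) → Fin n with IsFirstReturn t x, trajectoryProb P t x

/-- The mean first recurrence time `μ_t = ∑ m f_m` of the state `t`. -/
noncomputable def meanRecurrenceTime {n : ℕ} (P : Matrix (Fin n) (Fin n) ℝ) (t : Fin n) : ℝ :=
  ∑' m : ℕ, (m : ℝ) * firstReturnProb P t m

end FiniteMarkov

/-!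
Write `‖x‖₁ = ∑ i, |x i|` for row vectors. Irreducibility and aperiodicity make all entries of some
power `P ^ k` at least some `δ > 0` (`eventually_pow_pos`). On vectors of coordinate sum zero the
matrix `P ^ k` acts as `P ^ k - δ 1 1ᵀ`, a nonnegative matrix with row sums `1 - n δ`; hence `P ^ k`
contracts `‖·‖₁` on these vectors, while `P` does not increase it, and `x P ^ m → 0` for every `x` of
coordinate sum zero (`tendsto_vecMul_pow_zero`). Since `P 1 = 1`, there is a nonzero `v` with
`v P = v`; its coordinate sum is nonzero by the convergence just stated, and normalising it gives `u`.
For a stochastic `y` the difference `y - u` has coordinate sum zero, so `y P ^ m → u`. A fixed point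
of the shifted map has coordinate sum one and is therefore a left eigenvector of `P`, so it is `u`.

For the recurrence times, let `Q` be `P` with column `t` replaced by zero: the chain killed on
entering `t`. Then `r m = (Q ^ m 1) t` is the probability of no return to `t` up to time `m`, and
`f (m + 1) = r m - r (m + 1)` (`firstReturnProb_succ`). The identity `u = u t eₜ + u Q` iterates to
`1 = u t ∑_{i < m} r i + u Q ^ m 1`. The row sums of `Q ^ k` are at most `1 - δ`, so the last term
tends to zero and `∑ r i = 1 / u t` (`hasSum_survival`). Telescoping gives `∑ f m = 1`, and summation
by parts gives `∑ m f m = ∑ r m = 1 / u t`.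
-/

open Matrix Finset

namespace FiniteMarkov

/-! ### Real sequences -/

/-- A nonnegative antitone sequence that shrinks by a factor `c < 1` over every `k` steps tends to
zero. -/
lemma tendsto_zero_of_antitone_of_add_le {a : ℕ → ℝ} (ha : Antitone a) (h0 : ∀ m, 0 ≤ a m)
    {c : ℝ} (hc : c < 1) {k : ℕ} (h : ∀ m, a (m + k) ≤ c * a m) : Tendsto a atTop (𝓝 0) := by
  have hl := tendsto_atTop_ciInf ha ⟨0, Set.forall_mem_range.2 h0⟩
  have hle := le_of_tendsto_of_tendsto' (hl.comp (tendsto_add_atTop_nat k)) (hl.const_mul c) h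
  have hge : 0 ≤ ⨅ m, a m := le_ciInf h0
  rwa [show ⨅ m, a m = 0 by nlinarith] at hl

/-- Summation by parts: for a nonnegative antitone summable `r`, the boundary term `m * r m` does
not contribute. -/
lemma hasSum_succ_mul_sub_succ {r : ℕ → ℝ} (hr : Antitone r) (h0 : ∀ m, 0 ≤ r m) {L : ℝ}
    (hL : HasSum r L) : HasSum (fun m : ℕ => ((m : ℝ) + 1) * (r m - r (m + 1))) L := by
  have hpart : ∀ M : ℕ, ∑ m ∈ range M, ((m : ℝ) + 1) * (r m - r (m + 1))
      = ∑ m ∈ range M, (r m - r M) := by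
    intro M
    induction M with
    | zero => simp
    | succ M ih =>
      rw [sum_range_succ, ih, sum_range_succ]
      simp only [sum_sub_distrib, sum_const, card_range, nsmul_eq_mul]
      ring
  have hg0 : ∀ m : ℕ, 0 ≤ ((m : ℝ) + 1) * (r m - r (m + 1)) := fun m =>
    mul_nonneg (by positivity) (sub_nonneg.2 (hr m.le_succ))
  have hle : ∀ M, ∑ m ∈ range M, ((m : ℝ) + 1) * (r m - r (m + 1)) ≤ L := by
    intro M
    rw [hpart]
    exact (sum_le_sum fun m _ => sub_le_self _ (h0 M)).trans (sum_le_hasSum _ (fun m _ => h0 m) hL)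
  have hsum := summable_of_sum_range_le hg0 hle
  have hge : L ≤ ∑' m : ℕ, ((m : ℝ) + 1) * (r m - r (m + 1)) := by
    refine le_of_tendsto' hL.tendsto_sum_nat fun N => ?_
    -- Drop the terms with index at least `N` from the `M`-th partial sum, then let `M → ∞`.
    have hlim : Tendsto (fun M => ∑ m ∈ range N, (r m - r M)) atTop (𝓝 (∑ m ∈ range N, r m)) := by
      refine tendsto_finsetSum _ fun m _ => ?_
      simpa using hL.summable.tendsto_atTop_zero.const_sub (r m)
    refine le_of_tendsto hlim ?_
    filter_upwards [eventually_ge_atTop N] with M hM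
    refine le_trans ?_ (hsum.sum_le_tsum (range M) fun m _ => hg0 m)
    rw [hpart]
    exact sum_le_sum_of_subset_of_nonneg (range_mono hM) fun m hm _ =>
      sub_nonneg.2 (hr (mem_range.1 hm).le)
  rw [← le_antisymm (Real.tsum_le_of_sum_range_le hg0 hle) hge]
  exact hsum.hasSum

/-! ### Stochastic matrices -/

section Stochastic

variable {ι : Type*} [Fintype ι] [DecidableEq ι] {P : Matrix ι ι ℝ}

lemma sum_vecMul_of_mem_rowStochastic (hP : P ∈ rowStochastic ℝ ι) (x : ι → ℝ) :
    ∑ j, (x ᵥ* P) j = ∑ i, x i := by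
  rw [← dotProduct_one, ← dotProduct_mulVec, hP.2, dotProduct_one]

lemma vecMul_pow_mem_stdSimplex (hP : P ∈ rowStochastic ℝ ι) {y : ι → ℝ}
    (hy : y ∈ stdSimplex ℝ ι) (m : ℕ) : y ᵥ* P ^ m ∈ stdSimplex ℝ ι :=
  ⟨nonneg_vecMul_of_mem_rowStochastic (pow_mem hP m) hy.1,
    (sum_vecMul_of_mem_rowStochastic (pow_mem hP m) y).trans hy.2⟩

lemma vecMul_pow_eq_self {v : ι → ℝ} (hv : v ᵥ* P = v) (m : ℕ) : v ᵥ* P ^ m = v := by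
  induction m with
  | zero => simp
  | succ m ih => rw [pow_succ, ← vecMul_vecMul, ih, hv]

/-- A stochastic matrix with entries at least `δ` contracts the `ℓ¹` norm on vectors of coordinate
sum zero: there, it agrees with the nonnegative matrix obtained by subtracting `δ` from each
entry. -/
lemma sum_abs_vecMul_le (hP : P ∈ rowStochastic ℝ ι) {δ : ℝ} (hδ : ∀ i j, δ ≤ P i j)
    {x : ι → ℝ} (hx : ∑ i, x i = 0) :
    ∑ j, |(x ᵥ* P) j| ≤ (1 - Fintype.card ι * δ) * ∑ i, |x i| := by
  have h1 : ∀ j, (x ᵥ* P) j = ∑ i, x i * (P i j - δ) := fun j => by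
    simp [vecMul, dotProduct, mul_sub, ← sum_mul, hx]
  calc ∑ j, |(x ᵥ* P) j| ≤ ∑ j, ∑ i, |x i| * (P i j - δ) := by
        refine sum_le_sum fun j _ => ?_
        rw [h1]
        refine (abs_sum_le_sum_abs _ _).trans_eq (sum_congr rfl fun i _ => ?_)
        rw [abs_mul, abs_of_nonneg (sub_nonneg.2 (hδ i j))]
    _ = (1 - Fintype.card ι * δ) * ∑ i, |x i| := by
        rw [sum_comm, mul_sum]
        refine sum_congr rfl fun i _ => ?_
        rw [← mul_sum, sum_sub_distrib, sum_row_of_mem_rowStochastic hP]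
        simp [mul_comm]

/-- An irreducible aperiodic nonnegative matrix is primitive, indeed all its large powers have
positive entries: the return times to a state form an additive submonoid of `ℕ` of gcd `1`, which
contains all large numbers. -/
lemma eventually_pow_pos (hirr : P.IsIrreducible)
    (haper : ∀ s : ι, Nat.setGcd {m : ℕ | 0 < (P ^ m) s s} = 1) :
    ∀ᶠ m in atTop, ∀ i j, 0 < (P ^ m) i j := by
  have hmul : ∀ a b i j l, 0 < (P ^ a) i j → 0 < (P ^ b) j l → 0 < (P ^ (a + b)) i l := by
    intro a b i j l h1 h2
    rw [pow_add, mul_apply]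
    exact (mul_pos h1 h2).trans_le (single_le_sum (f := fun x => (P ^ a) i x * (P ^ b) x l)
      (fun x _ => mul_nonneg (pow_apply_nonneg hirr.nonneg a i x)
        (pow_apply_nonneg hirr.nonneg b x l)) (mem_univ j))
  refine eventually_all.2 fun i => eventually_all.2 fun j => ?_
  obtain ⟨k, -, hk⟩ := (isIrreducible_iff_exists_pow_pos hirr.nonneg).1 hirr i j
  obtain ⟨N, hN⟩ := Nat.exists_mem_closure_of_ge {m : ℕ | 0 < (P ^ m) i i}
  have hcl : ∀ m ∈ AddSubmonoid.closure {m : ℕ | 0 < (P ^ m) i i}, 0 < (P ^ m) i i := by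
    intro m hm
    induction hm using AddSubmonoid.closure_induction with
    | mem m hm => exact hm
    | zero => simp
    | add a b _ _ ha hb => exact hmul a b i i i ha hb
  filter_upwards [eventually_ge_atTop (N + k)] with m hm
  have := hmul (m - k) k i i j (hcl _ (hN _ (by omega) (by simp [haper i]))) hk
  rwa [Nat.sub_add_cancel (by omega)] at this

lemma exists_pow_ge (hirr : P.IsIrreducible)
    (haper : ∀ s : ι, Nat.setGcd {m : ℕ | 0 < (P ^ m) s s} = 1) [Nonempty ι] :
    ∃ k, 0 < k ∧ ∃ δ > 0, ∀ i j, δ ≤ (P ^ k) i j := by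
  obtain ⟨k, hpos, hk⟩ := ((eventually_pow_pos hirr haper).and (eventually_gt_atTop 0)).exists
  obtain ⟨⟨a, b⟩, hab⟩ := Finite.exists_min fun p : ι × ι => (P ^ k) p.1 p.2
  exact ⟨k, hk, _, hpos a b, fun i j => hab (i, j)⟩

variable {k : ℕ} {δ : ℝ}

lemma tendsto_vecMul_pow_zero [Nonempty ι] (hP : P ∈ rowStochastic ℝ ι) (hδ : 0 < δ)
    (hk : ∀ i j, δ ≤ (P ^ k) i j) {x : ι → ℝ} (hx : ∑ i, x i = 0) :
    Tendsto (fun m => x ᵥ* P ^ m) atTop (𝓝 0) := by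
  have hx' : ∀ m, ∑ i, (x ᵥ* P ^ m) i = 0 := fun m => by
    rw [sum_vecMul_of_mem_rowStochastic (pow_mem hP m), hx]
  have hlim : Tendsto (fun m => ∑ i, |(x ᵥ* P ^ m) i|) atTop (𝓝 0) := by
    refine tendsto_zero_of_antitone_of_add_le (c := 1 - Fintype.card ι * δ) (k := k)
      (antitone_nat_of_succ_le fun m => ?_) (fun m => sum_nonneg fun i _ => abs_nonneg _)
      (sub_lt_self _ (mul_pos (by exact_mod_cast Fintype.card_pos) hδ)) fun m => ?_
    · have := sum_abs_vecMul_le hP (fun i j => hP.1 i j) (hx' m)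
      rwa [mul_zero, sub_zero, one_mul, vecMul_vecMul, ← pow_succ] at this
    · have := sum_abs_vecMul_le (pow_mem hP k) hk (hx' m)
      rwa [vecMul_vecMul, ← pow_add] at this
  refine tendsto_pi_nhds.2 fun j => squeeze_zero_norm (fun m => ?_) hlim
  exact single_le_sum (f := fun i => |(x ᵥ* P ^ m) i|) (fun i _ => abs_nonneg _) (mem_univ j)

lemma eq_zero_of_vecMul_eq_self [Nonempty ι] (hP : P ∈ rowStochastic ℝ ι) (hδ : 0 < δ)
    (hk : ∀ i j, δ ≤ (P ^ k) i j) {v : ι → ℝ} (hv : v ᵥ* P = v) (hv0 : ∑ i, v i = 0) : v = 0 := by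
  have := tendsto_vecMul_pow_zero hP hδ hk hv0
  simp only [vecMul_pow_eq_self hv] at this
  exact tendsto_nhds_unique tendsto_const_nhds this

lemma tendsto_vecMul_pow [Nonempty ι] (hP : P ∈ rowStochastic ℝ ι) (hδ : 0 < δ)
    (hk : ∀ i j, δ ≤ (P ^ k) i j) {u y : ι → ℝ} (hu : u ᵥ* P = u) (hu1 : ∑ i, u i = 1)
    (hy1 : ∑ i, y i = 1) : Tendsto (fun m => y ᵥ* P ^ m) atTop (𝓝 u) := by
  have := (tendsto_vecMul_pow_zero hP hδ hk (x := y - u) (by simp [hu1, hy1])).add_const u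
  simpa [sub_vecMul, vecMul_pow_eq_self hu] using this

lemma exists_vecMul_eq_self_mem_stdSimplex [Nonempty ι] (hP : P ∈ rowStochastic ℝ ι) (hδ : 0 < δ)
    (hk : ∀ i j, δ ≤ (P ^ k) i j) : ∃ u ∈ stdSimplex ℝ ι, u ᵥ* P = u := by
  have hdet : (P - 1).det = 0 :=
    exists_mulVec_eq_zero_iff.1 ⟨1, one_ne_zero, by rw [sub_mulVec, hP.2, one_mulVec, sub_self]⟩
  obtain ⟨v, hv0, hv⟩ := exists_vecMul_eq_zero_iff.2 hdet
  rw [vecMul_sub, vecMul_one, sub_eq_zero] at hv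
  have hs : ∑ i, v i ≠ 0 := fun h => hv0 (eq_zero_of_vecMul_eq_self hP hδ hk hv h)
  set u : ι → ℝ := (∑ i, v i)⁻¹ • v with hu_def
  have hu : u ᵥ* P = u := by rw [hu_def, smul_vecMul, hv]
  have hu1 : ∑ i, u i = 1 := by simp [hu_def, ← mul_sum, hs]
  -- The sign of `v` is unknown; `u` is nonnegative as a limit of probability vectors.
  obtain ⟨s⟩ := ‹Nonempty ι›
  have hs := single_mem_stdSimplex ℝ s
  exact ⟨u, (isClosed_stdSimplex ℝ ι).mem_of_tendsto (tendsto_vecMul_pow hP hδ hk hu hu1 hs.2)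
    (Eventually.of_forall fun m => vecMul_pow_mem_stdSimplex hP hs m), hu⟩

lemma pos_of_vecMul_eq_self (hδ : 0 < δ) (hk : ∀ i j, δ ≤ (P ^ k) i j) {u : ι → ℝ}
    (hu : u ᵥ* P = u) (hus : u ∈ stdSimplex ℝ ι) (t : ι) : 0 < u t := by
  refine hδ.trans_le ?_
  calc δ = ∑ i, u i * δ := by rw [← sum_mul, hus.2, one_mul]
    _ ≤ ∑ i, u i * (P ^ k) i t := sum_le_sum fun i _ => mul_le_mul_of_nonneg_left (hk i t) (hus.1 i)
    _ = u t := congrFun (vecMul_pow_eq_self hu k) t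

/-! ### The chain killed on entering a state -/

/-- The matrix `P` with column `t` replaced by zero: the transition matrix of the chain killed on
entering `t`. The entry `(Q ^ m) s j` is the probability of going from `s` to `j` in `m` steps
without visiting `t` at any of the times `1, …, m`. -/
def killedMatrix (P : Matrix ι ι ℝ) (t : ι) : Matrix ι ι ℝ := P.updateCol t 0

omit [Fintype ι] in
lemma killedMatrix_nonneg (hP : ∀ i j, 0 ≤ P i j) (t i j : ι) : 0 ≤ killedMatrix P t i j := by
  unfold killedMatrix
  rw [updateCol_apply]
  split_ifs <;> simp [hP]

lemma killedMatrix_pow_le (hP : ∀ i j, 0 ≤ P i j) (t : ι) (m : ℕ) (i j : ι) :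
    (killedMatrix P t ^ m) i j ≤ (P ^ m) i j := by
  induction m generalizing j with
  | zero => simp
  | succ m ih =>
    rw [pow_succ, pow_succ, mul_apply, mul_apply]
    refine sum_le_sum fun l _ => mul_le_mul (ih l) ?_ (killedMatrix_nonneg hP t l j)
      (pow_apply_nonneg hP m i l)
    unfold killedMatrix
    rw [updateCol_apply]
    split_ifs <;> simp [hP]

lemma killedMatrix_pow_apply_self (t : ι) {m : ℕ} (hm : 0 < m) (i : ι) :
    (killedMatrix P t ^ m) i t = 0 := by
  obtain ⟨m, rfl⟩ := Nat.exists_eq_succ_of_ne_zero hm.ne'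
  rw [pow_succ, mul_apply]
  simp [killedMatrix]

lemma sum_killedMatrix (hP : P ∈ rowStochastic ℝ ι) (t i : ι) :
    ∑ j, killedMatrix P t i j = 1 - P i t := by
  have h : ∀ j, killedMatrix P t i j = P i j - if j = t then P i t else 0 := fun j => by
    rcases eq_or_ne j t with rfl | hj <;> simp [killedMatrix, *]
  simp only [h, sum_sub_distrib, sum_row_of_mem_rowStochastic hP]
  simp

lemma vecMul_killedMatrix_add {u : ι → ℝ} (hu : u ᵥ* P = u) (t : ι) :
    u ᵥ* killedMatrix P t + Pi.single t (u t) = u := by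
  ext j
  rcases eq_or_ne j t with rfl | hj
  · simp [killedMatrix, vecMul, dotProduct]
  · simpa [killedMatrix, vecMul, dotProduct, hj] using congrFun hu j

/-- The probability that the chain started in `s` avoids `t` at all times `1, …, m`. -/
def survivalProb (P : Matrix ι ι ℝ) (t s : ι) (m : ℕ) : ℝ := (killedMatrix P t ^ m *ᵥ 1) s

lemma survivalProb_eq_sum (t s : ι) (m : ℕ) :
    survivalProb P t s m = ∑ j, (killedMatrix P t ^ m) s j := by
  simp [survivalProb, mulVec, dotProduct]

lemma survivalProb_nonneg (hP : ∀ i j, 0 ≤ P i j) (t s : ι) (m : ℕ) : 0 ≤ survivalProb P t s m := by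
  rw [survivalProb_eq_sum]
  exact sum_nonneg fun j _ => pow_apply_nonneg (killedMatrix_nonneg hP t) m s j

lemma survivalProb_sub_succ (hP : P ∈ rowStochastic ℝ ι) (t s : ι) (m : ℕ) :
    survivalProb P t s m - survivalProb P t s (m + 1)
      = (killedMatrix P t ^ m *ᵥ fun i => P i t) s := by
  have : (1 : ι → ℝ) - killedMatrix P t *ᵥ 1 = fun i => P i t := by
    ext i
    have := sum_killedMatrix hP t i
    simp only [Pi.sub_apply, Pi.one_apply, mulVec, dotProduct, mul_one]
    linarith
  rw [survivalProb, survivalProb, pow_succ, ← mulVec_mulVec, ← Pi.sub_apply, ← mulVec_sub, this]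

lemma survivalProb_antitone (hP : P ∈ rowStochastic ℝ ι) (t s : ι) :
    Antitone (survivalProb P t s) :=
  antitone_nat_of_succ_le fun m => by
    rw [← sub_nonneg, survivalProb_sub_succ hP]
    exact sum_nonneg fun j _ =>
      mul_nonneg (pow_apply_nonneg (killedMatrix_nonneg hP.1 t) m s j) (hP.1 j t)

/-- If every state leads to `t` in `k` steps with probability at least `δ`, the chain is killed
within `k` steps with probability at least `δ`. -/
lemma survivalProb_le (hP : P ∈ rowStochastic ℝ ι) (hk0 : 0 < k) (hk : ∀ i j, δ ≤ (P ^ k) i j)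
    (t s : ι) : survivalProb P t s k ≤ 1 - δ := by
  have h1 := sum_row_of_mem_rowStochastic (pow_mem hP k) s
  have h2 : δ ≤ ∑ j, ((P ^ k) s j - (killedMatrix P t ^ k) s j) := by
    refine (hk s t).trans ?_
    have := single_le_sum (f := fun j => (P ^ k) s j - (killedMatrix P t ^ k) s j)
      (fun j _ => sub_nonneg.2 (killedMatrix_pow_le hP.1 t k s j)) (mem_univ t)
    simpa [killedMatrix_pow_apply_self t hk0] using this
  rw [sum_sub_distrib, h1] at h2
  rw [survivalProb_eq_sum]
  linarith

/-- The survival probabilities sum to `1 / u t`, for `u` the stationary distribution. -/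
lemma hasSum_survival (hP : P ∈ rowStochastic ℝ ι) (hδ : 0 < δ) (hk0 : 0 < k)
    (hk : ∀ i j, δ ≤ (P ^ k) i j) {u : ι → ℝ} (hu : u ᵥ* P = u) (hus : u ∈ stdSimplex ℝ ι) (t : ι) :
    HasSum (survivalProb P t t) (1 / u t) := by
  have hut := pos_of_vecMul_eq_self hδ hk hu hus t
  have hstep : ∀ (x : ι → ℝ) m l, (x ᵥ* killedMatrix P t ^ (m + l)) ⬝ᵥ 1
      = (x ᵥ* killedMatrix P t ^ m) ⬝ᵥ fun s => survivalProb P t s l := by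
    intro x m l
    rw [pow_add, ← vecMul_vecMul, ← dotProduct_mulVec]
    rfl
  have hmass : ∀ m, 0 ≤ u ᵥ* killedMatrix P t ^ m := fun m j =>
    sum_nonneg fun i _ => mul_nonneg (hus.1 i)
      (pow_apply_nonneg (killedMatrix_nonneg hP.1 t) m i j)
  -- The mass surviving `m` steps from the stationary distribution.
  have hlim : Tendsto (fun m => (u ᵥ* killedMatrix P t ^ m) ⬝ᵥ 1) atTop (𝓝 0) := by
    refine tendsto_zero_of_antitone_of_add_le (c := 1 - δ) (k := k)
      (antitone_nat_of_succ_le fun m => ?_)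
      (fun m => dotProduct_nonneg_of_nonneg (hmass m) zero_le_one) (by linarith) fun m => ?_
    · rw [hstep]
      refine dotProduct_le_dotProduct_of_nonneg_left (fun s => ?_) (hmass m)
      refine (survivalProb_antitone hP t s (Nat.zero_le 1)).trans_eq ?_
      simp [survivalProb]
    · rw [hstep, ← smul_eq_mul, ← dotProduct_smul]
      refine dotProduct_le_dotProduct_of_nonneg_left (fun s => ?_) (hmass m)
      simpa using survivalProb_le hP hk0 hk t s
  have hid : ∀ m, u t * ∑ i ∈ range m, survivalProb P t t i
      = 1 - (u ᵥ* killedMatrix P t ^ m) ⬝ᵥ 1 := by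
    intro m
    induction m with
    | zero => simp [dotProduct_one, hus.2]
    | succ m ih =>
      have h := congrArg (fun x => (x ᵥ* killedMatrix P t ^ m) ⬝ᵥ (1 : ι → ℝ))
        (vecMul_killedMatrix_add hu t)
      simp only [add_vecMul, add_dotProduct, vecMul_vecMul, ← pow_succ'] at h
      rw [← dotProduct_mulVec (Pi.single t (u t)), single_dotProduct] at h
      rw [sum_range_succ, mul_add, ih, ← h, survivalProb]
      ring
  rw [hasSum_iff_tendsto_nat_of_nonneg (survivalProb_nonneg hP.1 t t)]
  have := (hlim.const_sub 1).div_const (u t)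
  simp only [← hid, sub_zero] at this
  simpa [mul_div_cancel_left₀ _ hut.ne'] using this

end Stochastic

/-! ### First return probabilities -/

variable {n : ℕ} {P : Matrix (Fin n) (Fin n) ℝ}

lemma isFirstReturn_cons (t a : Fin n) {m : ℕ} (x : Fin (m + 2) → Fin n) :
    IsFirstReturn t (Fin.cons a x : Fin (m + 3) → Fin n) ↔ x 0 ≠ t ∧ IsFirstReturn t x := by
  simp only [IsFirstReturn, ← Fin.succ_last (m + 1), Fin.cons_succ, Fin.forall_fin_succ (n := m + 2),
    Fin.forall_fin_succ (n := m + 1), Fin.succ_lt_succ_iff, Fin.succ_pos, lt_self_iff_false]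
  have : 0 < Fin.last (m + 1) := Fin.last_pos
  simp [this]
  tauto

lemma trajectoryProb_cons (s a : Fin n) {m : ℕ} (x : Fin (m + 1) → Fin n) :
    trajectoryProb P s (Fin.cons a x : Fin (m + 2) → Fin n)
      = if a = s then P s (x 0) * trajectoryProb P (x 0) x else 0 := by
  simp only [trajectoryProb, Fin.cons_zero, Fin.prod_univ_succ, Fin.cons_succ, Fin.castSucc_zero,
    ← Fin.succ_castSucc, if_true]
  split_ifs with h
  · rw [h]
  · rfl

open Classical in
/-- The probability of first reaching `t` from `s` at time `m + 1`, as a power of the killed matrix: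
the trajectories are decomposed according to their first step. -/
lemma sum_trajectoryProb_isFirstReturn (t s : Fin n) (m : ℕ) :
    ∑ x : Fin (m + 2) → Fin n with IsFirstReturn t x, trajectoryProb P s x
      = (killedMatrix P t ^ m *ᵥ fun i => P i t) s := by
  induction m generalizing s with
  | zero =>
    rw [sum_filter, ← (finTwoArrowEquiv (Fin n)).symm.sum_comp, Fintype.sum_prod_type]
    simp [IsFirstReturn, trajectoryProb, Fin.forall_fin_two]
  | succ m ih =>
    rw [pow_succ', ← mulVec_mulVec, mulVec, dotProduct]
    simp only [← ih]
    rw [sum_filter, ← (Fin.consEquiv fun _ => Fin n).sum_comp, Fintype.sum_prod_type]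
    simp only [sum_filter, mul_sum]
    refine sum_comm.trans (Eq.trans (sum_congr rfl fun x _ => ?_) sum_comm)
    simp only [Fin.consEquiv, Equiv.coe_fn_mk, isFirstReturn_cons, trajectoryProb_cons]
    rw [sum_eq_single s (fun a _ ha => by simp [ha]) (by simp),
      sum_eq_single (x 0) (fun j _ hj => by simp [trajectoryProb, hj.symm]) (by simp),
      killedMatrix, updateCol_apply]
    by_cases h : x 0 = t <;> simp [h]

lemma firstReturnProb_zero (t : Fin n) : firstReturnProb P t 0 = 0 := by
  simp [firstReturnProb, IsFirstReturn]

lemma firstReturnProb_succ (hP : P ∈ rowStochastic ℝ (Fin n)) (t : Fin n) (m : ℕ) :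
    firstReturnProb P t (m + 1) = survivalProb P t t m - survivalProb P t t (m + 1) := by
  rw [survivalProb_sub_succ hP, ← sum_trajectoryProb_isFirstReturn]
  rfl

lemma hasSum_firstReturnProb (hP : P ∈ rowStochastic ℝ (Fin n)) {t : Fin n}
    (h : Summable (survivalProb P t t)) : HasSum (firstReturnProb P t) 1 := by
  rw [← hasSum_nat_add_iff' 1, sum_range_one, firstReturnProb_zero, sub_zero]
  simp only [firstReturnProb_succ hP]
  rw [hasSum_iff_tendsto_nat_of_nonneg
    fun m => sub_nonneg.2 (survivalProb_antitone hP t t m.le_succ)]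
  simp only [sum_range_sub']
  simpa [survivalProb] using h.tendsto_atTop_zero.const_sub (survivalProb P t t 0)

lemma hasSum_mul_firstReturnProb (hP : P ∈ rowStochastic ℝ (Fin n)) {t : Fin n} {L : ℝ}
    (h : HasSum (survivalProb P t t) L) :
    HasSum (fun m : ℕ => (m : ℝ) * firstReturnProb P t m) L := by
  rw [← hasSum_nat_add_iff' 1, sum_range_one, firstReturnProb_zero, mul_zero, sub_zero]
  simpa [firstReturnProb_succ hP] using
    hasSum_succ_mul_sub_succ (survivalProb_antitone hP t t) (survivalProb_nonneg hP.1 t t) h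

/-! ### The shifted map -/

lemma shiftMap_apply (x : Fin n → ℝ) (j : Fin n) :
    shiftMap P x j = (x ᵥ* P) j - (1 / (n : ℝ)) * ∑ i, x i + 1 / (n : ℝ) := by
  simp [shiftMap, vecMul, dotProduct, mul_sub, ← sum_mul, mul_comm]

/-- The fixed points of the shifted map are the invariant vectors of coordinate sum one. -/
lemma isFixedPt_shiftMap_iff (hn : 0 < n) (hP : P ∈ rowStochastic ℝ (Fin n)) (x : Fin n → ℝ) :
    Function.IsFixedPt (shiftMap P) x ↔ x ᵥ* P = x ∧ ∑ i, x i = 1 := by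
  have hn' : (n : ℝ) ≠ 0 := by exact_mod_cast hn.ne'
  have key : ∑ i, x i = 1 → shiftMap P x = x ᵥ* P := fun h => by
    ext j
    simp [shiftMap_apply, h]
  constructor
  · intro h
    have hs : ∑ i, x i = 1 := by
      -- Sum the fixed point equation over all coordinates.
      have h1 : ∑ j, shiftMap P x j = ∑ j, x j := by rw [h.eq]
      simp only [shiftMap_apply, sum_add_distrib, sum_sub_distrib,
        sum_vecMul_of_mem_rowStochastic hP, sum_const, card_univ, Fintype.card_fin,
        nsmul_eq_mul] at h1
      field_simp at h1
      linarith
    exact ⟨(key hs).symm.trans h, hs⟩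
  · rintro ⟨h, hs⟩
    exact (key hs).trans h

end FiniteMarkov

/-! ### The limit theorem -/

theorem mainTheorem1 (n : ℕ) (hn : 0 < n) (P : Matrix (Fin n) (Fin n) ℝ)
    (hP : P ∈ Matrix.rowStochastic ℝ (Fin n))
    (hirr : P.IsIrreducible) (haper : FiniteMarkov.IsAperiodic P) :
    (∃ u : Fin n → ℝ,
      Function.IsFixedPt (FiniteMarkov.shiftMap P) u ∧
      (∀ v : Fin n → ℝ, Function.IsFixedPt (FiniteMarkov.shiftMap P) v → v = u) ∧
      u ∈ stdSimplex ℝ (Fin n) ∧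
      Module.End.HasEigenvector (Matrix.vecMulLinear P) 1 u ∧
      (∀ y ∈ stdSimplex ℝ (Fin n),
        Tendsto (fun m : ℕ => Matrix.vecMul y (P ^ m)) atTop (𝓝 u)) ∧
      (∀ E ∈ Matrix.rowStochastic ℝ (Fin n),
        Tendsto (fun m : ℕ => E * P ^ m) atTop (𝓝 (Matrix.vecMulVec 1 u)))) ∧
    (∀ t : Fin n,
      HasSum (FiniteMarkov.firstReturnProb P t) 1 ∧
      Summable (fun m : ℕ => (m : ℝ) * FiniteMarkov.firstReturnProb P t m) ∧
      0 < FiniteMarkov.meanRecurrenceTime P t ∧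
      (∀ s : Fin n, Tendsto (fun m : ℕ => (P ^ m) s t) atTop
        (𝓝 (1 / FiniteMarkov.meanRecurrenceTime P t)))) := by
  have : Nonempty (Fin n) := ⟨⟨0, hn⟩⟩
  obtain ⟨k, hk0, δ, hδ, hk⟩ := FiniteMarkov.exists_pow_ge hirr haper
  obtain ⟨u, hus, hu⟩ := FiniteMarkov.exists_vecMul_eq_self_mem_stdSimplex hP hδ hk
  have hlim : ∀ y ∈ stdSimplex ℝ (Fin n),
      Tendsto (fun m : ℕ => Matrix.vecMul y (P ^ m)) atTop (𝓝 u) :=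
    fun y hy => FiniteMarkov.tendsto_vecMul_pow hP hδ hk hu hus.2 hy.2
  refine ⟨⟨u, (FiniteMarkov.isFixedPt_shiftMap_iff hn hP u).2 ⟨hu, hus.2⟩, ?_, hus, ?_, hlim, ?_⟩,
    ?_⟩
  · intro v hv
    obtain ⟨hvP, hv1⟩ := (FiniteMarkov.isFixedPt_shiftMap_iff hn hP v).1 hv
    exact sub_eq_zero.1 (FiniteMarkov.eq_zero_of_vecMul_eq_self hP hδ hk
      (by rw [Matrix.sub_vecMul, hvP, hu]) (by simp [hv1, hus.2]))
  · rw [Module.End.hasEigenvector_iff, Module.End.mem_eigenspace_iff]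
    refine ⟨by simpa using hu, ?_⟩
    rintro rfl
    simpa using hus.2
  · intro E hE
    refine tendsto_pi_nhds.2 fun i => ?_
    have := hlim (E i) ⟨fun j => hE.1 i j, Matrix.sum_row_of_mem_rowStochastic hE i⟩
    have hrow : Matrix.vecMulVec 1 u i = u := by ext j; simp [Matrix.vecMulVec_apply]
    rw [hrow]
    exact this
  · intro t
    have hr := FiniteMarkov.hasSum_survival hP hδ hk0 hk hu hus t
    have hμ := FiniteMarkov.hasSum_mul_firstReturnProb hP hr
    have hmean : FiniteMarkov.meanRecurrenceTime P t = 1 / u t := hμ.tsum_eq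
    refine ⟨FiniteMarkov.hasSum_firstReturnProb hP hr.summable, hμ.summable, ?_, fun s => ?_⟩
    · rw [hmean]
      exact one_div_pos.2 (FiniteMarkov.pos_of_vecMul_eq_self hδ hk hu hus t)
    · rw [hmean, one_div_one_div]
      simpa using tendsto_pi_nhds.1 (hlim _ (single_mem_stdSimplex ℝ s)) t
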